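/- Let $d\in\{2,3\}$ and let $\Omega\subset\mathbb R^d$ be a bounded open set with Lipschitz boundary. Let $D_1,D_2,\Sigma_{a1},\Sigma_{a2},\Sigma_{1\to2}>0$ and $\nu_1\Sigma_{f1},\nu_2\Sigma_{f2},\alpha_1,\alpha_2\ge 0$ be real constants, and let $V=H^1(\Omega,\mathbb C)\times H^1(\Omega,\mathbb C)$. For $\phi=(\phi_1,\phi_2)$ and $v=(v_1,v_2)$ in $V$ put $$\begin{aligned} a(\phi,v)={}&\int_\Omega \big(D_1\nabla\phi_1\cdot\nabla\overline{v_1}+(\Sigma_{a1}+\Sigma_{1\to2})\,\phi_1\overline{v_1}\big)\,dx\\ &+\int_\Omega\big(D_2\nabla\phi_2\cdot\nabla\overline{v_2}+\Sigma_{a2}\,\phi_2\overline{v_2}-\Sigma_{1\to2}\,\phi_1\overline{v_2}\big)\,dx+\int_{\partial\Omega}\big(\alpha_1\phi_1\overline{v_1}+\alpha_2\phi_2\overline{v_2}\big)\,dS,\\ b(\phi,v)={}&\int_\Omega\big(\nu_1\Sigma_{f1}\,\phi_1+\nu_2\Sigma_{f2}\,\phi_2\big)\overline{v_1}\,dx,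 \end{aligned}$$ where the boundary values are taken in the sense of traces. Call $\lambda\in\mathbb C$ an eigenvalue of the (non-symmetric) two-group neutron transport problem if there is $(\phi_1,\phi_2)\in V$ with $(\phi_1,\phi_2)\ne(0,0)$ and $$a\big((\phi_1,\phi_2),(v_1,v_2)\big)=\lambda\, b\big((\phi_1,\phi_2),(v_1,v_2)\big)\qquad\text{for all }(v_1,v_2)\in V .$$ Then every eigenvalue $\lambda$ of this problem is a real number, and moreover $\lambda>0$. -/

import Mathlib

open MeasureTheory
open scoped ContDiff ComplexConjugate

noncomputable section

namespace NeutronTransport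

/-- `ℝᵈ` with its Euclidean norm. -/
abbrev Space (d : ℕ) : Type := EuclideanSpace ℝ (Fin d)

/-- A bounded open set of `ℝᵈ` with Lipschitz boundary: near every boundary point `p` there are a
unit vector `n` (the vertical direction of a rotated Cartesian coordinate system) and a Lipschitz
function `γ` of the coordinates orthogonal to `n` such that, close to `p`, the set is exactly the
region lying below the graph of `γ`. -/
structure IsBoundedLipschitzDomain {d : ℕ} (Ω : Set (Space d)) : Prop where
  isOpen : IsOpen Ω
  isBounded : Bornology.IsBounded Ω
  lipschitz_boundary : ∀ p ∈ frontier Ω,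
    ∃ (n : Space d) (γ : Space d → ℝ) (K : NNReal) (r : ℝ),
      ‖n‖ = 1 ∧ LipschitzWith K γ ∧ 0 < r ∧
      ∀ x ∈ Metric.ball p r, x ∈ Ω ↔ inner ℝ n x < γ (x - inner ℝ n x • n)

/-- `L²(Ω, ℂ)`. -/
abbrev L2 {d : ℕ} (Ω : Set (Space d)) : Type := Lp ℂ 2 (volume.restrict Ω)

/-- Square-integrable vector fields `Ω → ℂᵈ`. -/
abbrev L2Vec {d : ℕ} (Ω : Set (Space d)) : Type :=
  Lp (EuclideanSpace ℂ (Fin d)) 2 (volume.restrict Ω)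

/-- The field `g` is the weak gradient of `u` in `Ω`:
`∫_Ω u ∂ᵢψ = - ∫_Ω gᵢ ψ` for all `i` and all test functions `ψ ∈ C_c^∞(Ω)`. -/
def IsWeakGradient {d : ℕ} (Ω : Set (Space d)) (u : L2 Ω) (g : L2Vec Ω) : Prop :=
  ∀ ψ : Space d → ℝ, ContDiff ℝ ∞ ψ → HasCompactSupport ψ → tsupport ψ ⊆ Ω → ∀ i : Fin d,
    ∫ x in Ω, fderiv ℝ ψ x (EuclideanSpace.single i 1) • u x = -∫ x in Ω, ψ x • g x i

theorem integrable_smul_L2 {d : ℕ} {Ω : Set (Space d)} {F : Type*} [NormedAddCommGroup F]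
    [NormedSpace ℝ F] {χ : Space d → ℝ} (hχ : Continuous χ) (hc : HasCompactSupport χ)
    {f : Space d → F} (hf : MemLp f 2 (volume.restrict Ω)) :
    Integrable (fun x => χ x • f x) (volume.restrict Ω) := by
  have h : MemLp χ 2 (volume.restrict Ω) := (hχ.memLp_of_hasCompactSupport hc).restrict Ω
  exact memLp_one_iff_integrable.mp (hf.smul h)

theorem memLp_coord {d : ℕ} {Ω : Set (Space d)} (g : L2Vec Ω) (i : Fin d) :
    MemLp (fun x => g x i) 2 (volume.restrict Ω) :=
  (EuclideanSpace.proj i : EuclideanSpace ℂ (Fin d) →L[ℂ] ℂ).comp_memLp' (Lp.memLp g)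

theorem continuous_partial {d : ℕ} {ψ : Space d → ℝ} (hψ : ContDiff ℝ ∞ ψ) (v : Space d) :
    Continuous fun x => fderiv ℝ ψ x v :=
  (hψ.continuous_fderiv (by simp)).clm_apply continuous_const

theorem hasCompactSupport_partial {d : ℕ} {ψ : Space d → ℝ} (hc : HasCompactSupport ψ)
    (v : Space d) : HasCompactSupport fun x => fderiv ℝ ψ x v :=
  (hc.fderiv (𝕜 := ℝ)).comp_left (g := fun L : Space d →L[ℝ] ℝ => L v) (by simp)

theorem IsWeakGradient.zero {d : ℕ} (Ω : Set (Space d)) : IsWeakGradient Ω 0 0 := by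
  intro ψ _ _ _ i
  have h1 : (fun x => fderiv ℝ ψ x (EuclideanSpace.single i 1) • (0 : L2 Ω) x)
      =ᵐ[volume.restrict Ω] fun _ => 0 := by
    filter_upwards [Lp.coeFn_zero ℂ 2 (volume.restrict Ω)] with x hx
    rw [hx, Pi.zero_apply, smul_zero]
  have h2 : (fun x => ψ x • (0 : L2Vec Ω) x i) =ᵐ[volume.restrict Ω] fun _ => 0 := by
    filter_upwards [Lp.coeFn_zero (EuclideanSpace ℂ (Fin d)) 2 (volume.restrict Ω)] with x hx
    rw [hx, Pi.zero_apply, PiLp.zero_apply, smul_zero]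
  rw [integral_congr_ae h1, integral_congr_ae h2]
  simp

theorem IsWeakGradient.add {d : ℕ} {Ω : Set (Space d)} {u v : L2 Ω} {g k : L2Vec Ω}
    (hu : IsWeakGradient Ω u g) (hv : IsWeakGradient Ω v k) :
    IsWeakGradient Ω (u + v) (g + k) := by
  intro ψ hψ hc hs i
  have h1 : (fun x => fderiv ℝ ψ x (EuclideanSpace.single i 1) • (u + v) x)
      =ᵐ[volume.restrict Ω] fun x => fderiv ℝ ψ x (EuclideanSpace.single i 1) • u x +
        fderiv ℝ ψ x (EuclideanSpace.single i 1) • v x := by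
    filter_upwards [Lp.coeFn_add u v] with x hx
    rw [hx, Pi.add_apply, smul_add]
  have h2 : (fun x => ψ x • (g + k) x i) =ᵐ[volume.restrict Ω]
      fun x => ψ x • g x i + ψ x • k x i := by
    filter_upwards [Lp.coeFn_add g k] with x hx
    rw [hx, Pi.add_apply, PiLp.add_apply, smul_add]
  have hd := continuous_partial hψ (EuclideanSpace.single i 1)
  have hdc := hasCompactSupport_partial hc (EuclideanSpace.single i 1)
  rw [integral_congr_ae h1, integral_congr_ae h2,
    integral_add (integrable_smul_L2 hd hdc (Lp.memLp u)) (integrable_smul_L2 hd hdc (Lp.memLp v)),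
    integral_add (integrable_smul_L2 hψ.continuous hc (memLp_coord g i))
      (integrable_smul_L2 hψ.continuous hc (memLp_coord k i)),
    hu ψ hψ hc hs i, hv ψ hψ hc hs i, neg_add]

theorem IsWeakGradient.smul {d : ℕ} {Ω : Set (Space d)} {u : L2 Ω} {g : L2Vec Ω} (c : ℂ)
    (hu : IsWeakGradient Ω u g) : IsWeakGradient Ω (c • u) (c • g) := by
  intro ψ hψ hc hs i
  have h1 : (fun x => fderiv ℝ ψ x (EuclideanSpace.single i 1) • (c • u) x)
      =ᵐ[volume.restrict Ω] fun x => c • (fderiv ℝ ψ x (EuclideanSpace.single i 1) • u x) := by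
    filter_upwards [Lp.coeFn_smul c u] with x hx
    rw [hx, Pi.smul_apply, smul_comm]
  have h2 : (fun x => ψ x • (c • g) x i) =ᵐ[volume.restrict Ω] fun x => c • (ψ x • g x i) := by
    filter_upwards [Lp.coeFn_smul c g] with x hx
    rw [hx, Pi.smul_apply, PiLp.smul_apply, smul_comm]
  rw [integral_congr_ae h1, integral_congr_ae h2, integral_smul, integral_smul,
    hu ψ hψ hc hs i, smul_neg]

/-- The complex Sobolev space `H¹(Ω, ℂ)`: the functions `u ∈ L²(Ω, ℂ)` having a weak gradient
`g ∈ L²(Ω, ℂᵈ)`, each recorded together with that gradient as the pair `(u, g)`. As a subspace of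
the Hilbert sum `L² ⊕ L²` it carries the inner product `(u, v)₁ = (u, v)₀ + (∇u, ∇v)₀`. -/
def H1 {d : ℕ} (Ω : Set (Space d)) : Submodule ℂ (WithLp 2 (L2 Ω × L2Vec Ω)) where
  carrier := {p | IsWeakGradient Ω p.fst p.snd}
  zero_mem' := IsWeakGradient.zero Ω
  add_mem' hp hq := IsWeakGradient.add hp hq
  smul_mem' c _ hp := IsWeakGradient.smul c hp

/-- The underlying `L²` function of an element of `H¹(Ω, ℂ)`. -/
def value {d : ℕ} {Ω : Set (Space d)} (u : H1 Ω) : L2 Ω := (u : WithLp 2 (L2 Ω × L2Vec Ω)).fst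

/-- The weak gradient of an element of `H¹(Ω, ℂ)`. -/
def grad {d : ℕ} {Ω : Set (Space d)} (u : H1 Ω) : L2Vec Ω :=
  (u : WithLp 2 (L2 Ω × L2Vec Ω)).snd

/-- The weak gradient is determined by the function, so `H¹(Ω, ℂ)` is a space of functions. -/
theorem value_injective {d : ℕ} {Ω : Set (Space d)} (hΩ : IsOpen Ω) :
    Function.Injective (value : H1 Ω → L2 Ω) := by
  have key : ∀ w : H1 Ω, value w = 0 → w = 0 := by
    intro w hw
    have hgrad : grad w = 0 := by
      have hcoord : ∀ i : Fin d, ∀ᵐ x ∂volume, x ∈ Ω → grad w x i = 0 := by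
        intro i
        have hmem : MemLp (fun x => grad w x i) 2 (volume.restrict Ω) := memLp_coord (grad w) i
        refine hΩ.ae_eq_zero_of_integral_contDiff_smul_eq_zero ?_ ?_
        · rw [locallyIntegrableOn_iff hΩ.isLocallyClosed]
          · intro k hk hkc
            have : IsFiniteMeasure ((volume.restrict Ω).restrict k) :=
              ⟨by
                rw [Measure.restrict_apply_univ]
                exact (Measure.restrict_apply_le _ _).trans_lt hkc.measure_lt_top⟩
            have h := (hmem.restrict k).integrable (by norm_num)
            rwa [Measure.restrict_restrict_of_subset hk] at h
        · intro ψ hψ hc hs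
          have h := w.2 ψ hψ hc hs i
          have h1 : (fun x => fderiv ℝ ψ x (EuclideanSpace.single i 1) •
              (w : WithLp 2 (L2 Ω × L2Vec Ω)).fst x) =ᵐ[volume.restrict Ω] fun _ => 0 := by
            have hw' : (w : WithLp 2 (L2 Ω × L2Vec Ω)).fst = 0 := hw
            rw [hw']
            filter_upwards [Lp.coeFn_zero ℂ 2 (volume.restrict Ω)] with x hx
            rw [hx, Pi.zero_apply, smul_zero]
          rw [integral_congr_ae h1, integral_zero, eq_comm, neg_eq_zero] at h
          rw [← h]
          refine (setIntegral_eq_integral_of_forall_compl_eq_zero fun x hx => ?_).symm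
          rw [image_eq_zero_of_notMem_tsupport fun hx' => hx (hs hx'), zero_smul]
      refine Lp.ext ?_
      have hall : ∀ᵐ x ∂volume.restrict Ω, ∀ i : Fin d, grad w x i = 0 :=
        ae_all_iff.mpr fun i => (ae_restrict_iff' hΩ.measurableSet).mpr (hcoord i)
      filter_upwards [hall, Lp.coeFn_zero (EuclideanSpace ℂ (Fin d)) 2 (volume.restrict Ω)]
        with x hx h0
      rw [h0]
      ext i
      exact hx i
    apply Subtype.ext
    apply (WithLp.ofLp_injective 2)
    exact Prod.ext hw hgrad
  intro u v huv
  have h := key (u - v) (by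
    change value u - value v = 0
    rw [huv, sub_self])
  exact sub_eq_zero.mp h

/-- The surface measure `dS` on `∂Ω`: the `(d-1)`-dimensional Hausdorff measure, normalised so as
to agree with Lebesgue measure on `(d-1)`-dimensional Euclidean space. -/
def surfaceMeasure {d : ℕ} (Ω : Set (Space d)) : Measure (Space d) :=
  (Measure.euclideanHausdorffMeasure (d - 1)).restrict (frontier Ω)

/-- `L²(∂Ω, ℂ)`. -/
abbrev L2Boundary {d : ℕ} (Ω : Set (Space d)) : Type := Lp ℂ 2 (surfaceMeasure Ω)

/-- `γ` is a trace operator: a bounded linear operator `H¹(Ω, ℂ) → L²(∂Ω, ℂ)` that restricts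
every function smooth up to the boundary to `∂Ω`. -/
def IsTraceOperator {d : ℕ} (Ω : Set (Space d)) (γ : H1 Ω →L[ℂ] L2Boundary Ω) : Prop :=
  ∀ (w : Space d → ℂ) (u : H1 Ω), ContDiff ℝ ∞ w → value u =ᵐ[volume.restrict Ω] w →
    γ u =ᵐ[surfaceMeasure Ω] w

open Classical in
/-- The trace operator `H¹(Ω, ℂ) → L²(∂Ω, ℂ)`. For a bounded Lipschitz domain it exists and is
unique; the value `0` is used for sets without a trace operator. -/
def trace {d : ℕ} (Ω : Set (Space d)) : H1 Ω →L[ℂ] L2Boundary Ω :=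
  if h : ∃ γ, IsTraceOperator Ω γ then h.choose else 0

/-- The coefficients of the two-group model: diffusion coefficients `D₁, D₂`, absorption cross
sections `Σ_{a1}, Σ_{a2}`, scattering cross section `Σ_{1→2}`, fission coefficients
`ν₁Σ_{f1}, ν₂Σ_{f2}`, and the Robin coefficients `α₁, α₂`. -/
structure Coefficients where
  D₁ : ℝ
  D₂ : ℝ
  Sa₁ : ℝ
  Sa₂ : ℝ
  S₁₂ : ℝ
  νSf₁ : ℝ
  νSf₂ : ℝ
  α₁ : ℝ
  α₂ : ℝ

/-- The space `V = H¹(Ω, ℂ) × H¹(Ω, ℂ)`. -/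
abbrev V {d : ℕ} (Ω : Set (Space d)) : Type := H1 Ω × H1 Ω

/-- The sesquilinear form `a : V × V → ℂ`. -/
def formA {d : ℕ} (Ω : Set (Space d)) (c : Coefficients) (φ v : V Ω) : ℂ :=
  (∫ x in Ω, ((c.D₁ : ℂ) * ∑ i, grad φ.1 x i * starRingEnd ℂ (grad v.1 x i)
      + ((c.Sa₁ : ℂ) + (c.S₁₂ : ℂ)) * value φ.1 x * conj (value v.1 x)))
  + (∫ x in Ω, ((c.D₂ : ℂ) * ∑ i, grad φ.2 x i * starRingEnd ℂ (grad v.2 x i)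
      + (c.Sa₂ : ℂ) * value φ.2 x * conj (value v.2 x)
      - (c.S₁₂ : ℂ) * value φ.1 x * conj (value v.2 x)))
  + ∫ x, ((c.α₁ : ℂ) * trace Ω φ.1 x * conj (trace Ω v.1 x)
      + (c.α₂ : ℂ) * trace Ω φ.2 x * conj (trace Ω v.2 x)) ∂surfaceMeasure Ω

/-- The sesquilinear form `b`: fission neutrons are born in the fast group, so only the first
component of the test function enters. -/
def formB {d : ℕ} (Ω : Set (Space d)) (c : Coefficients) (φ v : V Ω) : ℂ :=
  ∫ x in Ω, ((c.νSf₁ : ℂ) * value φ.1 x + (c.νSf₂ : ℂ) * value φ.2 x) * conj (value v.1 x)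

/-- `lam` is an eigenvalue of the two-group problem: there is `0 ≠ φ ∈ V` with
`a(φ, v) = lam * b(φ, v)` for all `v ∈ V`. -/
def IsEigenvalue {d : ℕ} (Ω : Set (Space d)) (c : Coefficients) (lam : ℂ) : Prop :=
  ∃ φ : V Ω, φ ≠ 0 ∧ ∀ v : V Ω, formA Ω c φ v = lam * formB Ω c φ v

end NeutronTransport

end

open MeasureTheory

namespace NeutronTransport

/-! The coupling is one-way: fast neutrons feed the thermal group by scattering, and fission feeds
only the fast group. So test the eigenvalue equation with each component of `φ` separately. With
`(0, φ.2)` the form `b` vanishes and the thermal energy `E₂ ≥ 0` equals `S₁₂ * ⟨φ₁, φ₂⟩`; hence this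
inner product is real and nonnegative, although the problem is not symmetric. With `(φ.1, 0)` the
fast energy satisfies `E₁ = lam * q`, where `q` combines `‖φ₁‖²` and that same inner product, so `q
≥ 0`. Since `E₁ > 0`, `lam = E₁ / q` is positive. The identities are `formA_fast` and
`formA_thermal`; strict positivity is `groupEnergy_pos`. Of the trace, only linearity is used. -/

theorem integral_mul_conj_eq_inner {α : Type*} [MeasurableSpace α] {μ : Measure α}
    (f g : Lp ℂ 2 μ) : ∫ x, f x * starRingEnd ℂ (g x) ∂μ = inner ℂ g f := by
  rw [L2.inner_def]
  rfl

theorem integrable_mul_conj {α : Type*} [MeasurableSpace α] {μ : Measure α}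
    (f g : Lp ℂ 2 μ) : Integrable (fun x => f x * starRingEnd ℂ (g x)) μ :=
  L2.integrable_inner (𝕜 := ℂ) g f

theorem integral_sum_mul_conj_eq_inner {α ι : Type*} [Fintype ι] [MeasurableSpace α]
    {μ : Measure α} (f g : Lp (EuclideanSpace ℂ ι) 2 μ) :
    ∫ x, ∑ i, f x i * starRingEnd ℂ (g x i) ∂μ = inner ℂ g f := by
  rw [L2.inner_def]
  rfl

theorem integrable_sum_mul_conj {α ι : Type*} [Fintype ι] [MeasurableSpace α]
    {μ : Measure α} (f g : Lp (EuclideanSpace ℂ ι) 2 μ) :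
    Integrable (fun x => ∑ i, f x i * starRingEnd ℂ (g x i)) μ :=
  L2.integrable_inner (𝕜 := ℂ) g f

/-- The form `a` in terms of the inner products of `L²(Ω)`, `L²(Ω)ᵈ` and `L²(∂Ω)`. -/
theorem formA_eq_inner {d : ℕ} (Ω : Set (Space d)) (c : Coefficients) (φ v : V Ω) :
    formA Ω c φ v =
      (c.D₁ * inner ℂ (grad v.1) (grad φ.1)
        + (c.Sa₁ + c.S₁₂) * inner ℂ (value v.1) (value φ.1))
      + (c.D₂ * inner ℂ (grad v.2) (grad φ.2) + c.Sa₂ * inner ℂ (value v.2) (value φ.2)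
        - c.S₁₂ * inner ℂ (value v.2) (value φ.1))
      + (c.α₁ * inner ℂ (trace Ω v.1) (trace Ω φ.1)
        + c.α₂ * inner ℂ (trace Ω v.2) (trace Ω φ.2)) := by
  have hg := fun (k : ℂ) (p q : H1 Ω) =>
    (integrable_sum_mul_conj (grad p) (grad q)).const_mul k
  have hv := fun (k : ℂ) (p q : H1 Ω) => (integrable_mul_conj (value p) (value q)).const_mul k
  have ht := fun (k : ℂ) (p q : H1 Ω) =>
    (integrable_mul_conj (trace Ω p) (trace Ω q)).const_mul k
  simp only [formA, mul_assoc]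
  rw [integral_add (hg _ _ _) (hv _ _ _),
    integral_sub (f := fun x => _ + _) ((hg _ _ _).add (hv _ _ _)) (hv _ _ _),
    integral_add (hg _ _ _) (hv _ _ _), integral_add (ht _ _ _) (ht _ _ _)]
  simp only [integral_const_mul, integral_mul_conj_eq_inner, integral_sum_mul_conj_eq_inner]

/-- The form `b` in terms of the inner product of `L²(Ω)`. -/
theorem formB_eq_inner {d : ℕ} (Ω : Set (Space d)) (c : Coefficients) (φ v : V Ω) :
    formB Ω c φ v =
      c.νSf₁ * inner ℂ (value v.1) (value φ.1) + c.νSf₂ * inner ℂ (value v.1) (value φ.2) := by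
  have hv := fun (k : ℂ) (p q : H1 Ω) => (integrable_mul_conj (value p) (value q)).const_mul k
  simp only [formB, add_mul, mul_assoc]
  rw [integral_add (hv _ _ _) (hv _ _ _)]
  simp only [integral_const_mul, integral_mul_conj_eq_inner]

@[simp] theorem value_zero {d : ℕ} {Ω : Set (Space d)} : value (0 : H1 Ω) = 0 := rfl

@[simp] theorem grad_zero {d : ℕ} {Ω : Set (Space d)} : grad (0 : H1 Ω) = 0 := rfl

/-- The energy `D‖∇u‖² + S‖u‖² + α‖u‖²_∂Ω` of one energy group. -/
noncomputable def groupEnergy {d : ℕ} {Ω : Set (Space d)} (D S α : ℝ) (u : H1 Ω) : ℝ :=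
  D * ‖grad u‖ ^ 2 + S * ‖value u‖ ^ 2 + α * ‖trace Ω u‖ ^ 2

theorem groupEnergy_nonneg {d : ℕ} {Ω : Set (Space d)} {D S α : ℝ} (hD : 0 ≤ D) (hS : 0 ≤ S)
    (hα : 0 ≤ α) (u : H1 Ω) : 0 ≤ groupEnergy D S α u := by
  unfold groupEnergy
  positivity

/-- The absorption term alone gives strictness: a nonzero element of `H1 Ω` has nonzero `L²` part,
because the function determines its weak gradient. -/
theorem groupEnergy_pos {d : ℕ} {Ω : Set (Space d)} (hΩ : IsOpen Ω) {D S α : ℝ} (hD : 0 ≤ D)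
    (hS : 0 < S) (hα : 0 ≤ α) {u : H1 Ω} (hu : u ≠ 0) : 0 < groupEnergy D S α u := by
  have hv : 0 < ‖value u‖ := norm_pos_iff.mpr fun h => hu (value_injective hΩ h)
  unfold groupEnergy
  positivity

theorem formA_fast {d : ℕ} (Ω : Set (Space d)) (c : Coefficients) (φ : V Ω) :
    formA Ω c φ (φ.1, 0) = (groupEnergy c.D₁ (c.Sa₁ + c.S₁₂) c.α₁ φ.1 : ℝ) := by
  rw [formA_eq_inner]
  simp [groupEnergy, inner_self_eq_norm_sq_to_K]

/-- Down-scattering is tested against the second component, so it survives here, whereas it drops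
out of `formA_fast`. -/
theorem formA_thermal {d : ℕ} (Ω : Set (Space d)) (c : Coefficients) (φ : V Ω) :
    formA Ω c φ (0, φ.2) = (groupEnergy c.D₂ c.Sa₂ c.α₂ φ.2 : ℝ)
      - c.S₁₂ * inner ℂ (value φ.2) (value φ.1) := by
  rw [formA_eq_inner]
  simp [groupEnergy, inner_self_eq_norm_sq_to_K]
  ring

end NeutronTransport

open NeutronTransport in
theorem mainTheorem5 (d : ℕ) (hd : d = 2 ∨ d = 3)
    (Ω : Set (NeutronTransport.Space d)) (hΩ : NeutronTransport.IsBoundedLipschitzDomain Ω)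
    (c : NeutronTransport.Coefficients)
    (hD₁ : 0 < c.D₁) (hD₂ : 0 < c.D₂) (hSa₁ : 0 < c.Sa₁) (hSa₂ : 0 < c.Sa₂) (hS₁₂ : 0 < c.S₁₂)
    (hνSf₁ : 0 ≤ c.νSf₁) (hνSf₂ : 0 ≤ c.νSf₂) (hα₁ : 0 ≤ c.α₁) (hα₂ : 0 ≤ c.α₂)
    (lam : ℂ) (hlam : NeutronTransport.IsEigenvalue Ω c lam) :
    ∃ r : ℝ, 0 < r ∧ lam = (r : ℂ) := by
  obtain ⟨φ, hφ, h⟩ := hlam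
  set E₁ := groupEnergy c.D₁ (c.Sa₁ + c.S₁₂) c.α₁ φ.1 with hE₁
  set E₂ := groupEnergy c.D₂ c.Sa₂ c.α₂ φ.2 with hE₂
  have fast := h (φ.1, 0)
  have thermal := h (0, φ.2)
  rw [formA_fast, formB_eq_inner, ← hE₁] at fast
  rw [formA_thermal, formB_eq_inner, ← hE₂] at thermal
  simp only [value_zero, inner_zero_left, mul_zero, add_zero, sub_eq_zero] at thermal
  have hE₂0 : 0 ≤ E₂ := groupEnergy_nonneg hD₂.le hSa₂.le hα₂ φ.2
  -- Without a fast flux the thermal group has no source, so `E₂ = 0` and the thermal flux vanishes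
  -- too.
  have hφ₁ : φ.1 ≠ 0 := by
    intro h₁
    have h₂ : φ.2 ≠ 0 := fun h₂ => hφ (Prod.ext h₁ h₂)
    have : 0 < E₂ := groupEnergy_pos hΩ.isOpen hD₂.le hSa₂ hα₂ h₂
    rw [h₁, value_zero, inner_zero_right, mul_zero, Complex.ofReal_eq_zero] at thermal
    exact this.ne' thermal
  have hE₁0 : 0 < E₁ := groupEnergy_pos hΩ.isOpen hD₁.le (add_pos hSa₁ hS₁₂) hα₁ hφ₁
  have hS : (c.S₁₂ : ℂ) ≠ 0 := Complex.ofReal_ne_zero.mpr hS₁₂.ne'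
  -- The fission term contains the conjugate of the scattering inner product; being real, the two
  -- agree.
  have hinner : inner ℂ (value φ.1) (value φ.2) = ((E₂ / c.S₁₂ : ℝ) : ℂ) := by
    have h21 : inner ℂ (value φ.2) (value φ.1) = ((E₂ / c.S₁₂ : ℝ) : ℂ) := by
      rw [Complex.ofReal_div, thermal, mul_div_cancel_left₀ _ hS]
    rw [← inner_conj_symm, h21, Complex.conj_ofReal]
  set q : ℝ := c.νSf₁ * ‖value φ.1‖ ^ 2 + c.νSf₂ * (E₂ / c.S₁₂) with hq
  have hq0 : 0 ≤ q := by positivity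
  have key : (E₁ : ℂ) = lam * q := by
    rw [fast, hinner, inner_self_eq_norm_sq_to_K, hq]
    simp
  -- The fission coefficients may both vanish, so `q ≠ 0` has to come from `E₁ > 0`.
  have hqne : q ≠ 0 := by
    intro h0
    rw [h0, Complex.ofReal_zero, mul_zero, Complex.ofReal_eq_zero] at key
    exact hE₁0.ne' key
  refine ⟨E₁ / q, div_pos hE₁0 (hq0.lt_of_ne' hqne), ?_⟩
  rw [Complex.ofReal_div, key, mul_div_cancel_right₀ _ (Complex.ofReal_ne_zero.mpr hqne)]
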